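/- Let $n\ge 0$, let $u$ be a real-valued $C^\infty$ function on $(\mathbb C^{n+1})^*=\mathbb C^{n+1}\setminus\{0\}$ (no symmetry is assumed), and put $t=\log|z|$. Let $e_0,\dots,e_n$ be a smooth unitary frame field on an open set $U\subset(\mathbb C^{n+1})^*$ with $z=e^te_0$. Indices $\alpha,\beta,\gamma$ run over $1,\dots,n$, indices $A,B,C$ over $0,\dots,n$, and repeated indices are summed. Define - the $(1,0)$-forms $\omega^A$ by $dz=\omega^Ae_A$, the connection forms $\omega^B_C$ by $de_C=\omega^B_Ce_B$, and $\theta^\alpha=e^{-t}\omega^\alpha$, $\theta^\alpha_\beta=\omega^\alpha_\beta-\delta^\alpha_\beta\,\omega^0_0$; - the functions $u_A,u_{\bar A}$ by $\partial u=u_A\omega^A$, $\bar\partial u=u_{\bar A}\overline{\omega^A}$; - for a smooth function $f$ on $U$, the transversal differential $d^Tf$, which is the part of $df$ in the span of the $\theta^\alpha,\overline{\theta^\alpha}$ when $df$ is expanded in $\omega^0,\overline{\omega^0},\theta^\alpha,\overline{\theta^\alpha}$; - $u_{0,\bar 0}$ by $du_{\bar 0}=e^{-t}u_{0,\bar 0}\,\omega^0+e^{-t}u_{\bar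 0,\bar 0}\,\overline{\omega^0}+d^Tu_{\bar 0}$, further $u_{\alpha,\bar 0}$ by $d^Tu_{\bar 0}=u_{\alpha,\bar 0}\theta^\alpha+u_{\bar\alpha,\bar 0}\overline{\theta^\alpha}$ and $u_{\bar\alpha,0}$ by $d^Tu_0=u_{\alpha,0}\theta^\alpha+u_{\bar\alpha,0}\overline{\theta^\alpha}$; - $u_{\alpha\bar\beta}$ as the coefficient of $\theta^\alpha$ in $\nabla u_{\bar\beta}=d^Tu_{\bar\beta}-u_{\bar\gamma}\,\overline{\theta^\gamma_\beta}$, expanded in $\omega^0,\overline{\omega^0},\theta^\alpha,\overline{\theta^\alpha}$. Then on $U$ $$\partial\bar\partial u=e^{-t}\Big(u_{0,\bar0}+\tfrac12u_{\bar0}\Big)\,\omega^0\wedge\overline{\omega^0}+u_{\bar\alpha,0}\,\omega^0\wedge\overline{\theta^\alpha}+u_{\alpha,\bar0}\,\theta^\alpha\wedge\overline{\omega^0}+e^t\big(u_{\bar0}\delta_{\alpha\beta}+u_{\alpha\bar\beta}\big)\,\theta^\alpha\wedge\overline{\theta^\beta}.$$ If moreover $u$ is plurisubharmonic on $(\mathbb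 C^{n+1})^*$, then on $U$ $$u_{0,\bar0}+\tfrac12u_{\bar0}\ \ge\ 0\qquad\text{(in particular this number is real)}$$ and $\big(u_{\bar0}\delta_{\alpha\beta}+u_{\alpha\bar\beta}\big)\,i\theta^\alpha\wedge\overline{\theta^\beta}\ge0$ as a $(1,1)$-form. Here a $(1,1)$-form $T$ is $\ge0$ if $T(v,iv)$ is real and nonnegative for all tangent vectors $v$. -/

import Mathlib

open scoped ContDiff ComplexOrder

noncomputable section

namespace HopfFrame

/-- The complex Euclidean space `ℂⁿ⁺¹`, with coordinates `z⁰, …, zⁿ` and its standard hermitian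
inner product. -/
abbrev Cspace (n : ℕ) : Type := EuclideanSpace ℂ (Fin (n + 1))

/-- The punctured space `(ℂⁿ⁺¹)^*`. -/
def punctured (n : ℕ) : Set (Cspace n) := {0}ᶜ

/-! ### Complex-valued one-forms and two-forms at a point

A complex-valued one-form at a point is a real-linear map `ℂⁿ⁺¹ → ℂ`; a complex-valued two-form
is a real-bilinear alternating map. -/

/-- Complex-valued one-forms at a point. -/
abbrev OneForm (n : ℕ) : Type := Cspace n →L[ℝ] ℂ

/-- Complex-valued two-forms at a point. -/
abbrev TwoForm (n : ℕ) : Type := Cspace n [⋀^Fin 2]→L[ℝ] ℂ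

variable {n : ℕ}

/-- The standard complex structure, multiplication by `i`, as a real-linear map. -/
def mulI (n : ℕ) : Cspace n →L[ℝ] Cspace n :=
  (Complex.I • ContinuousLinearMap.id ℂ (Cspace n)).restrictScalars ℝ

/-- The complex conjugate of a one-form. -/
def conjForm (φ : OneForm n) : OneForm n :=
  (Complex.conjCLE : ℂ →L[ℝ] ℂ).comp φ

/-- The wedge product of two one-forms, `(φ ∧ ψ)(v, w) = φ(v) ψ(w) - φ(w) ψ(v)`. -/
def wedge (φ ψ : OneForm n) : TwoForm n :=
  ContinuousMultilinearMap.alternatization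
    ((ContinuousMultilinearMap.mkPiAlgebra ℝ (Fin 2) ℂ).compContinuousLinearMap ![φ, ψ])

theorem wedge_apply (φ ψ : OneForm n) (v w : Cspace n) :
    wedge φ ψ ![v, w] = φ v * ψ w - φ w * ψ v := by
  have h : (Finset.univ : Finset (Equiv.Perm (Fin 2))) = {1, Equiv.swap 0 1} := by decide
  rw [wedge, ContinuousMultilinearMap.alternatization_apply_apply, h,
    Finset.sum_pair (by decide)]
  simp [Fin.prod_univ_two, sub_eq_add_neg]

/-- The `(1,0)`-part of a one-form. -/
def part10 (φ : OneForm n) : OneForm n :=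
  (1 / 2 : ℂ) • (φ - Complex.I • φ.comp (mulI n))

/-- The `(0,1)`-part of a one-form. -/
def part01 (φ : OneForm n) : OneForm n :=
  (1 / 2 : ℂ) • (φ + Complex.I • φ.comp (mulI n))

/-! ### The operators `d`, `∂`, `∂̄` on functions and the complex Hessian -/

/-- The differential `df` at the point `z`. -/
def d (f : Cspace n → ℂ) (z : Cspace n) : OneForm n := fderiv ℝ f z

/-- `∂f`, the `(1,0)`-part of `df`. -/
def del (f : Cspace n → ℂ) (z : Cspace n) : OneForm n := part10 (d f z)

/-- `∂̄f`, the `(0,1)`-part of `df`. -/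
def delBar (f : Cspace n → ℂ) (z : Cspace n) : OneForm n := part01 (d f z)

/-- The coordinate form `dz^A`. -/
def dz (A : Fin (n + 1)) : OneForm n :=
  (EuclideanSpace.proj A : Cspace n →L[ℂ] ℂ).restrictScalars ℝ

/-- The Wirtinger derivative `∂f/∂z^A = (∂f/∂x^A - i ∂f/∂y^A) / 2`. -/
def wirt (A : Fin (n + 1)) (f : Cspace n → ℂ) (z : Cspace n) : ℂ :=
  (1 / 2 : ℂ) * (fderiv ℝ f z (EuclideanSpace.single A 1)
    - Complex.I * fderiv ℝ f z (EuclideanSpace.single A Complex.I))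

/-- The Wirtinger derivative `∂f/∂z̄^A = (∂f/∂x^A + i ∂f/∂y^A) / 2`. -/
def wirtBar (A : Fin (n + 1)) (f : Cspace n → ℂ) (z : Cspace n) : ℂ :=
  (1 / 2 : ℂ) * (fderiv ℝ f z (EuclideanSpace.single A 1)
    + Complex.I * fderiv ℝ f z (EuclideanSpace.single A Complex.I))

/-- The complex Hessian `∂∂̄f = ∑_{A,B} (∂²f / ∂z^A ∂z̄^B) dz^A ∧ dz̄^B`. -/
def delDelBar (f : Cspace n → ℂ) (z : Cspace n) : TwoForm n :=
  ∑ A, ∑ B, wirt A (wirtBar B f) z • wedge (dz A) (conjForm (dz B))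

/-! ### Positivity -/

/-- A two-form is a positive `(1,1)`-form if it is of type `(1,1)`, that is, invariant under the
complex structure, and `T(v, iv)` is real and nonnegative for every vector `v`. For
`T = ∑ h_{αβ} i θ^α ∧ θ̄^β` one has `T(v, iv) = 2 ∑ h_{αβ} θ^α(v) θ̄^β(v)`. -/
def IsPositive (T : TwoForm n) : Prop :=
  (∀ v w, T ![mulI n v, mulI n w] = T ![v, w]) ∧ ∀ v, 0 ≤ T ![v, mulI n v]

/-- A real-valued function is plurisubharmonic on `Ω` if it is upper semicontinuous on `Ω` and
satisfies the sub-mean value inequality on every closed complex disc `{z + ζ w : |ζ| ≤ 1}`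
contained in `Ω`. -/
def PshOn (u : Cspace n → ℝ) (Ω : Set (Cspace n)) : Prop :=
  UpperSemicontinuousOn u Ω ∧
    ∀ z w : Cspace n, (∀ ζ : ℂ, ‖ζ‖ ≤ 1 → z + ζ • w ∈ Ω) →
      u z ≤ Real.circleAverage (fun ζ : ℂ => u (z + ζ • w)) 0 1

/-! ### Moving frames adapted to the Hopf fibration -/

/-- The radial variable `t = log |z|`. -/
def t (z : Cspace n) : ℝ := Real.log ‖z‖

/-- A smooth unitary frame field `e_0, …, e_n` on an open set `U ⊆ (ℂⁿ⁺¹)^*` whose first element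
is the unit vector towards the point, `z = e^t e_0`. -/
structure IsHopfFrame (U : Set (Cspace n)) (e : Fin (n + 1) → Cspace n → Cspace n) : Prop where
  isOpen : IsOpen U
  subset : U ⊆ punctured n
  smooth : ∀ A, ContDiffOn ℝ ∞ (e A) U
  unitary : ∀ z ∈ U, Orthonormal ℂ (fun A => e A z)
  radial : ∀ z ∈ U, z = Real.exp (t z) • e 0 z

/-- The unitary coframe `ω^A`, defined by `dz = ω^A e_A`, that is `ω^A(v) = (v, e_A)`. -/
def omega (e : Fin (n + 1) → Cspace n → Cspace n) (A : Fin (n + 1)) (z : Cspace n) : OneForm n :=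
  (innerSL ℂ (e A z)).restrictScalars ℝ

/-- The connection forms `ω^B_C`, defined by `de_C = ω^B_C e_B`. -/
def omegaConn (e : Fin (n + 1) → Cspace n → Cspace n) (B C : Fin (n + 1)) (z : Cspace n) :
    OneForm n :=
  (omega e B z).comp (fderiv ℝ (e C) z)

/-- The transversal coframe `θ^α = e^{-t} ω^α`, for `α = 1, …, n`. -/
def theta (e : Fin (n + 1) → Cspace n → Cspace n) (α : Fin n) (z : Cspace n) : OneForm n :=
  Real.exp (-t z) • omega e α.succ z

/-- The connection forms `θ^α_β = ω^α_β - δ^α_β ω^0_0` of the coframe `θ^α`. -/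
def thetaConn (e : Fin (n + 1) → Cspace n → Cspace n) (α β : Fin n) (z : Cspace n) : OneForm n :=
  omegaConn e α.succ β.succ z - if α = β then omegaConn e 0 0 z else 0

/-- The coefficient of `ω^A` in the expansion of a one-form in `ω^B`, `ω̄^B`. -/
def coeff (e : Fin (n + 1) → Cspace n → Cspace n) (A : Fin (n + 1)) (z : Cspace n)
    (φ : OneForm n) : ℂ :=
  part10 φ (e A z)

/-- The coefficient of `ω̄^A` in the expansion of a one-form in `ω^B`, `ω̄^B`. -/
def coeffBar (e : Fin (n + 1) → Cspace n → Cspace n) (A : Fin (n + 1)) (z : Cspace n)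
    (φ : OneForm n) : ℂ :=
  part01 φ (e A z)

/-- `coeff` and `coeffBar` are the coefficients of a one-form in the coframe `ω^A`, `ω̄^A`. -/
theorem eq_sum_coeff (e : Fin (n + 1) → Cspace n → Cspace n) (z : Cspace n)
    (he : Orthonormal ℂ (fun A => e A z)) (φ : OneForm n) :
    φ = ∑ A, (coeff e A z φ • omega e A z + coeffBar e A z φ • conjForm (omega e A z)) := by
  have hcard : Fintype.card (Fin (n + 1)) = Module.finrank ℂ (Cspace n) := by simp
  let b := (basisOfOrthonormalOfCardEqFinrank he hcard).toOrthonormalBasis (by simpa using he)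
  have hb : ∀ A, b A = e A z := fun A => by simp [b]
  have key : ∀ (c : ℂ) (w : Cspace n),
      φ (c • w) = part10 φ w * c + part01 φ w * (starRingEnd ℂ) c := by
    intro c w
    have h : c • w = c.re • w + c.im • (Complex.I • w) := by
      conv_lhs => rw [← Complex.re_add_im c]
      rw [add_smul, mul_smul]
      simp
    rw [h, map_add, map_smul, map_smul]
    simp only [part10, part01, mulI, smul_apply,
      add_apply, sub_apply,
      ContinuousLinearMap.comp_apply, ContinuousLinearMap.coe_restrictScalars',
      ContinuousLinearMap.id_apply, smul_eq_mul, Complex.real_smul]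
    have h1 := Complex.re_add_im c
    have h2 : (starRingEnd ℂ) c = c.re - c.im * Complex.I := by
      apply Complex.ext <;> simp
    rw [h2]
    nth_rewrite 3 [← h1]
    ring_nf
    rw [Complex.I_sq]
    ring
  ext v
  conv_lhs => rw [← b.sum_repr v]
  simp only [map_sum, key, sum_apply, add_apply,
    smul_apply, smul_eq_mul, coeff, coeffBar, omega, conjForm, hb,
    b.repr_apply_apply]
  rfl

/-- The coefficient of `θ^α`: since `θ^α = e^{-t} ω^α`, it is `e^t` times that of `ω^α`. -/
def thetaCoeff (e : Fin (n + 1) → Cspace n → Cspace n) (α : Fin n) (z : Cspace n)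
    (φ : OneForm n) : ℂ :=
  Real.exp (t z) * coeff e α.succ z φ

/-- The coefficient of `θ̄^α`. -/
def thetaCoeffBar (e : Fin (n + 1) → Cspace n → Cspace n) (α : Fin n) (z : Cspace n)
    (φ : OneForm n) : ℂ :=
  Real.exp (t z) * coeffBar e α.succ z φ

/-- The transversal differential `d^T f`: the part of `df` in the span of `θ^α`, `θ̄^α`, obtained
by removing the `ω^0` and `ω̄^0` components. -/
def dT (e : Fin (n + 1) → Cspace n → Cspace n) (f : Cspace n → ℂ) (z : Cspace n) : OneForm n :=
  d f z - coeff e 0 z (d f z) • omega e 0 z - coeffBar e 0 z (d f z) • conjForm (omega e 0 z)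

/-! ### Components of the derivatives of a function in the frame -/

/-- `u_A`, defined by `∂u = u_A ω^A`. -/
def comp (e : Fin (n + 1) → Cspace n → Cspace n) (u : Cspace n → ℂ) (A : Fin (n + 1))
    (z : Cspace n) : ℂ :=
  coeff e A z (del u z)

/-- `u_{Ā}`, defined by `∂̄u = u_{Ā} ω̄^A`. -/
def compBar (e : Fin (n + 1) → Cspace n → Cspace n) (u : Cspace n → ℂ) (A : Fin (n + 1))
    (z : Cspace n) : ℂ :=
  coeffBar e A z (delBar u z)

/-- `u_{0,0̄}`, defined by `du_{0̄} = u_{0,0̄} e^{-t} ω^0 + u_{0̄,0̄} e^{-t} ω̄^0 + d^T u_{0̄}`. -/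
def radialRadialBar (e : Fin (n + 1) → Cspace n → Cspace n) (u : Cspace n → ℂ)
    (z : Cspace n) : ℂ :=
  Real.exp (t z) * coeff e 0 z (d (compBar e u 0) z)

/-- `u_{α,0̄}`, defined by `d^T u_{0̄} = u_{α,0̄} θ^α + u_{ᾱ,0̄} θ̄^α`. -/
def transRadialBar (e : Fin (n + 1) → Cspace n → Cspace n) (u : Cspace n → ℂ) (α : Fin n)
    (z : Cspace n) : ℂ :=
  thetaCoeff e α z (dT e (compBar e u 0) z)

/-- `u_{ᾱ,0}`, defined by `d^T u_0 = u_{α,0} θ^α + u_{ᾱ,0} θ̄^α`. -/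
def transBarRadial (e : Fin (n + 1) → Cspace n → Cspace n) (u : Cspace n → ℂ) (α : Fin n)
    (z : Cspace n) : ℂ :=
  thetaCoeffBar e α z (dT e (comp e u 0) z)

/-- The transversal covariant differential `∇u_{β̄} = d^T u_{β̄} - u_{γ̄} conj(θ^γ_β)`. -/
def nablaBar (e : Fin (n + 1) → Cspace n → Cspace n) (u : Cspace n → ℂ) (β : Fin n)
    (z : Cspace n) : OneForm n :=
  dT e (compBar e u β.succ) z - ∑ γ, compBar e u γ.succ z • conjForm (thetaConn e γ β z)

/-- `u_{αβ̄}`, the coefficient of `θ^α` in `∇u_{β̄}`. -/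
def transTransBar (e : Fin (n + 1) → Cspace n → Cspace n) (u : Cspace n → ℂ) (α β : Fin n)
    (z : Cspace n) : ℂ :=
  thetaCoeff e α z (nablaBar e u β z)

/-- The transversal matrix `u_{0̄} δ_{αβ} + u_{αβ̄}`. -/
def transHess (e : Fin (n + 1) → Cspace n → Cspace n) (u : Cspace n → ℂ) (α β : Fin n)
    (z : Cspace n) : ℂ :=
  (if α = β then compBar e u 0 z else 0) + transTransBar e u α β z

end HopfFrame

end

open HopfFrame

namespace HopfFrame

open Complex

variable {n : ℕ}

/-! All coefficients in the formula are values of one sesquilinear form: with `H = hess u z`, the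
complex Hessian is `∂∂̄u(v, w) = H(v, w) - H(w, v)` (`delDelBar_apply`), so expanding `H` in the
unitary frame reduces the identity to computing `H(e_A, e_B)`. Since `u_{B̄}` is `∂̄u` evaluated on
the moving vector `e_B`, differentiating it in the (1,0)-direction `e_A` gives `H(e_A, e_B)` plus
`∂̄u` applied to `(∂̄e_B)(e_A)` (`coeff_d_compBar`). The correction is explicit. From `e_0 = z/|z|`
one gets `∂̄e_0(a) = -(1/2|z|) conj⟨e_0, a⟩ e_0`, the source of `½u_{0̄}`. By unitarity
`(∂̄e_β)(e_α)` has `e_0`-component `-δ_{αβ}/|z|`, the source of `u_{0̄}δ_{αβ}`; its other components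
are the connection terms removed by `∇`. Hence each component equals `|z| H(e_A, e_B)`. For
plurisubharmonic `u`, `hess_self_nonneg` gives `H(w, w) ≥ 0` by a second-order Taylor expansion in
the sub-mean value inequality. The radial inequality is the case `w = e_0`; the transversal one
takes `w` to be the projection of `v` to the complement of `e_0`. -/

theorem part10_apply (φ : OneForm n) (v : Cspace n) :
    part10 φ v = 1 / 2 * (φ v - I * φ (I • v)) := rfl

theorem part01_apply (φ : OneForm n) (v : Cspace n) :
    part01 φ v = 1 / 2 * (φ v + I * φ (I • v)) := rfl

theorem oneForm_smul (φ : OneForm n) (c : ℂ) (v : Cspace n) :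
    φ (c • v) = c.re * φ v + c.im * φ (I • v) := by
  have h : c • v = c.re • v + c.im • (I • v) := by
    conv_lhs => rw [← re_add_im c]
    rw [add_smul, mul_smul]
    simp
  rw [h, map_add, map_smul, map_smul]
  simp

theorem oneForm_I_smul_smul (φ : OneForm n) (c : ℂ) (v : Cspace n) :
    φ (I • c • v) = c.re * φ (I • v) - c.im * φ v := by
  rw [smul_comm, oneForm_smul, smul_smul, I_mul_I, neg_one_smul, map_neg]
  ring

theorem part10_smul (φ : OneForm n) (c : ℂ) (v : Cspace n) :
    part10 φ (c • v) = c * part10 φ v := by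
  rw [part10_apply, part10_apply, oneForm_smul, oneForm_I_smul_smul]
  conv_rhs => rw [← re_add_im c]
  linear_combination (1 / 2 * c.im * φ (I • v)) * I_sq

theorem part01_smul (φ : OneForm n) (c : ℂ) (v : Cspace n) :
    part01 φ (c • v) = (starRingEnd ℂ) c * part01 φ v := by
  rw [part01_apply, part01_apply, oneForm_smul, oneForm_I_smul_smul]
  have : (starRingEnd ℂ) c = c.re - c.im * I := by apply Complex.ext <;> simp
  rw [this]
  linear_combination (1 / 2 * c.im * φ (I • v)) * I_sq

theorem part10_part10 (φ : OneForm n) : part10 (part10 φ) = part10 φ := by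
  ext v
  rw [part10_apply (part10 φ), part10_smul]
  linear_combination (-1 / 2 * part10 φ v) * I_sq

theorem part01_part01 (φ : OneForm n) : part01 (part01 φ) = part01 φ := by
  ext v
  rw [part01_apply (part01 φ), part01_smul, conj_I]
  linear_combination (-1 / 2 * part01 φ v) * I_sq

theorem part10_sub (φ ψ : OneForm n) : part10 (φ - ψ) = part10 φ - part10 ψ := by
  ext v
  simp only [part10_apply, sub_apply]
  ring

theorem part10_smul_form (c : ℂ) (φ : OneForm n) : part10 (c • φ) = c • part10 φ := by
  ext v
  simp only [part10_apply, smul_apply, smul_eq_mul]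
  ring

theorem part01_sub (φ ψ : OneForm n) : part01 (φ - ψ) = part01 φ - part01 ψ := by
  ext v
  simp only [part01_apply, sub_apply]
  ring

theorem part01_smul_form (c : ℂ) (φ : OneForm n) : part01 (c • φ) = c • part01 φ := by
  ext v
  simp only [part01_apply, smul_apply, smul_eq_mul]
  ring

theorem part10_sum {ι : Type*} (s : Finset ι) (φ : ι → OneForm n) :
    part10 (∑ i ∈ s, φ i) = ∑ i ∈ s, part10 (φ i) := by
  ext v
  simp only [part10_apply, sum_apply, Finset.mul_sum, ← Finset.sum_sub_distrib]

theorem part10_conjForm_apply (φ : OneForm n) (v : Cspace n) :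
    part10 (conjForm φ) v = (starRingEnd ℂ) (part01 φ v) := by
  simp [part10_apply, part01_apply, conjForm, sub_eq_add_neg, map_ofNat]

/-! ### The complex Hessian as a sesquilinear form. -/

/-- Evaluation of the `(0,1)`-part of a one-form at a vector. -/
noncomputable def part01Eval (b : Cspace n) : OneForm n →L[ℝ] ℂ :=
  (1 / 2 : ℂ) • (ContinuousLinearMap.apply ℝ ℂ b + I • ContinuousLinearMap.apply ℝ ℂ (I • b))

theorem part01Eval_apply (b : Cspace n) (φ : OneForm n) : part01Eval b φ = part01 φ b := rfl

/-- The second differential of a function. -/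
noncomputable def d2 (f : Cspace n → ℂ) (z : Cspace n) : Cspace n →L[ℝ] OneForm n :=
  fderiv ℝ (d f) z

/-- The complex Hessian of a function as a sesquilinear form. -/
noncomputable def hess (f : Cspace n → ℂ) (z : Cspace n) :
    Cspace n →ₗ[ℂ] Cspace n →ₗ⋆[ℂ] ℂ :=
  LinearMap.mk₂'ₛₗ (RingHom.id ℂ) (starRingEnd ℂ)
    (fun a b => part10 ((part01Eval b).comp (d2 f z)) a)
    (fun _ _ _ => map_add _ _ _)
    (fun c m b => part10_smul _ c m)
    (fun m b b' => by
      simp only [part10_apply, ContinuousLinearMap.comp_apply, part01Eval_apply, map_add]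
      ring)
    (fun c m b => by
      simp only [part10_apply, ContinuousLinearMap.comp_apply, part01Eval_apply, part01_smul,
        smul_eq_mul]
      ring)

theorem hess_apply (f : Cspace n → ℂ) (z a b : Cspace n) :
    hess f z a b = 1 / 2 * (part01 (d2 f z a) b - I * part01 (d2 f z (I • a)) b) := rfl

theorem hess_apply' (f : Cspace n → ℂ) (z a b : Cspace n) :
    hess f z a b = 1 / 4 * (d2 f z a b + I * d2 f z a (I • b) - I * d2 f z (I • a) b
      + d2 f z (I • a) (I • b)) := by
  rw [hess_apply, part01_apply, part01_apply]
  linear_combination (-1 / 4 * d2 f z (I • a) (I • b)) * I_sq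

theorem sesquilinear_expand {E ι : Type*} [Fintype ι] [NormedAddCommGroup E]
    [InnerProductSpace ℂ E] (H : E →ₗ[ℂ] E →ₗ⋆[ℂ] ℂ) (b : OrthonormalBasis ι ℂ E) (v w : E) :
    H v w = ∑ i, ∑ j, H (b i) (b j) * (inner ℂ (b i) v * (starRingEnd ℂ) (inner ℂ (b j) w)) := by
  conv_lhs => rw [← b.sum_repr v, ← b.sum_repr w]
  simp only [map_sum, LinearMap.sum_apply, map_smul, map_smulₛₗ, LinearMap.smul_apply,
    smul_eq_mul, b.repr_apply_apply]
  simp only [Finset.mul_sum]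
  rw [Finset.sum_comm]
  refine Finset.sum_congr rfl fun i _ => Finset.sum_congr rfl fun j _ => ?_
  ring

theorem wirt_wirtBar (f : Cspace n → ℂ) (z : Cspace n) (hf : DifferentiableAt ℝ (d f) z)
    (A B : Fin (n + 1)) :
    wirt A (wirtBar B f) z =
      hess f z (EuclideanSpace.single A 1) (EuclideanSpace.single B 1) := by
  have hs : ∀ C : Fin (n + 1),
      (EuclideanSpace.single C I : Cspace n) = I • EuclideanSpace.single C 1 := by
    intro C; ext i; by_cases h : i = C <;> simp [h]
  have h1 : wirtBar B f = fun x => part01Eval (EuclideanSpace.single B 1) (d f x) := by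
    ext x; rw [wirtBar, hs]; rfl
  have h2 : fderiv ℝ (wirtBar B f) z
      = (part01Eval (EuclideanSpace.single B 1)).comp (d2 f z) := by
    rw [h1]
    exact ((part01Eval _).hasFDerivAt.comp z hf.hasFDerivAt).fderiv
  rw [wirt, h2, hs]
  rfl

/-- This removes the coordinates: the standard basis is used only here, and the same form can then
be expanded in the moving frame. -/
theorem delDelBar_apply (f : Cspace n → ℂ) (z : Cspace n) (hf : DifferentiableAt ℝ (d f) z)
    (v w : Cspace n) : delDelBar f z ![v, w] = hess f z v w - hess f z w v := by
  rw [sesquilinear_expand (hess f z) (EuclideanSpace.basisFun _ ℂ) v w,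
    sesquilinear_expand (hess f z) (EuclideanSpace.basisFun _ ℂ) w v]
  simp only [delDelBar, ← Finset.sum_sub_distrib, ContinuousAlternatingMap.sum_apply,
    ContinuousAlternatingMap.smul_apply, wedge_apply, wirt_wirtBar f z hf,
    EuclideanSpace.basisFun_apply, EuclideanSpace.inner_single_left, smul_eq_mul, map_one, one_mul]
  refine Finset.sum_congr rfl fun i _ => Finset.sum_congr rfl fun j _ => ?_
  simp [dz, conjForm]
  ring

/-! ### Differentiating `∂u` and `∂̄u` along a moving vector field. -/

theorem fderiv_part01_apply (f : Cspace n → ℂ) (E : Cspace n → Cspace n) (z : Cspace n)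
    (hf : DifferentiableAt ℝ (d f) z) (hE : DifferentiableAt ℝ E z) (v : Cspace n) :
    fderiv ℝ (fun x => part01 (d f x) (E x)) z v
      = part01 (d2 f z v) (E z) + part01 (d f z) (fderiv ℝ E z v) := by
  have h1 := hf.hasFDerivAt.clm_apply hE.hasFDerivAt
  have h2 := hf.hasFDerivAt.clm_apply ((mulI n).hasFDerivAt.comp z hE.hasFDerivAt)
  have h := ((h1.add (h2.const_smul I)).const_smul (1 / 2 : ℂ)).fderiv
  have h3 : (fun x => part01 (d f x) (E x))
      = (1 / 2 : ℂ) • ((fun x => d f x (E x)) + I • fun x => d f x ((mulI n ∘ E) x)) := rfl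
  rw [h3, h]
  simp only [part01_apply, smul_apply, add_apply, ContinuousLinearMap.comp_apply,
    ContinuousLinearMap.flip_apply, smul_eq_mul, d2]
  simp only [mulI, Function.comp_apply, ContinuousLinearMap.coe_restrictScalars', smul_apply,
    ContinuousLinearMap.id_apply]
  ring

theorem fderiv_part10_apply (f : Cspace n → ℂ) (E : Cspace n → Cspace n) (z : Cspace n)
    (hf : DifferentiableAt ℝ (d f) z) (hE : DifferentiableAt ℝ E z) (v : Cspace n) :
    fderiv ℝ (fun x => part10 (d f x) (E x)) z v
      = part10 (d2 f z v) (E z) + part10 (d f z) (fderiv ℝ E z v) := by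
  have h1 := hf.hasFDerivAt.clm_apply hE.hasFDerivAt
  have h2 := hf.hasFDerivAt.clm_apply ((mulI n).hasFDerivAt.comp z hE.hasFDerivAt)
  have h := ((h1.sub (h2.const_smul I)).const_smul (1 / 2 : ℂ)).fderiv
  have h3 : (fun x => part10 (d f x) (E x))
      = (1 / 2 : ℂ) • ((fun x => d f x (E x)) - I • fun x => d f x ((mulI n ∘ E) x)) := rfl
  rw [h3, h]
  simp only [part10_apply, smul_apply, add_apply, sub_apply, ContinuousLinearMap.comp_apply,
    ContinuousLinearMap.flip_apply, smul_eq_mul, d2]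
  simp only [mulI, Function.comp_apply, ContinuousLinearMap.coe_restrictScalars', smul_apply,
    ContinuousLinearMap.id_apply]
  ring

/-- The correction involves the (0,1)-part of `dE`, although a (1,0)-derivative is taken, because
`∂̄f` is conjugate-linear in the vector. -/
theorem part10_fderiv_part01 (f : Cspace n → ℂ) (E : Cspace n → Cspace n) (z : Cspace n)
    (hf : DifferentiableAt ℝ (d f) z) (hE : DifferentiableAt ℝ E z) (a : Cspace n) :
    part10 (fderiv ℝ (fun x => part01 (d f x) (E x)) z) a
      = hess f z a (E z) + part01 (d f z)
        ((1 / 2 : ℂ) • (fderiv ℝ E z a + I • fderiv ℝ E z (I • a))) := by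
  rw [part10_apply, fderiv_part01_apply f E z hf hE, fderiv_part01_apply f E z hf hE, hess_apply,
    part01_smul, map_add, part01_smul, conj_I]
  simp [map_ofNat]
  ring

/-- Here the derivatives come in the opposite order, so symmetry of the second differential is
needed to recover the same `hess`, with its arguments exchanged. -/
theorem part01_fderiv_part10 (f : Cspace n → ℂ) (E : Cspace n → Cspace n) (z : Cspace n)
    (hf : DifferentiableAt ℝ (d f) z) (hE : DifferentiableAt ℝ E z)
    (hsymm : ∀ v w, d2 f z v w = d2 f z w v) (a : Cspace n) :
    part01 (fderiv ℝ (fun x => part10 (d f x) (E x)) z) a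
      = hess f z (E z) a + part10 (d f z)
        ((1 / 2 : ℂ) • (fderiv ℝ E z a + I • fderiv ℝ E z (I • a))) := by
  rw [part01_apply, fderiv_part10_apply f E z hf hE, fderiv_part10_apply f E z hf hE, hess_apply',
    part10_smul, map_add, part10_smul, part10_apply, part10_apply (d2 f z (I • a)),
    hsymm a, hsymm a, hsymm (I • a), hsymm (I • a)]
  linear_combination (-1 / 4 * d2 f z (I • E z) (I • a)) * I_sq

/-- The `(0,1)`-part of the differential of a vector field, evaluated at a vector. -/
noncomputable def dbarVec (E : Cspace n → Cspace n) (z a : Cspace n) : Cspace n :=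
  (1 / 2 : ℂ) • (fderiv ℝ E z a + I • fderiv ℝ E z (I • a))

theorem part10_omega (e : Fin (n + 1) → Cspace n → Cspace n) (A : Fin (n + 1)) (z : Cspace n) :
    part10 (omega e A z) = omega e A z := by
  ext v
  rw [part10_apply]
  simp only [omega, ContinuousLinearMap.coe_restrictScalars', innerSL_apply_apply, inner_smul_right]
  linear_combination (-1 / 2 * inner ℂ (e A z) v) * I_sq

theorem part01_omega (e : Fin (n + 1) → Cspace n → Cspace n) (A : Fin (n + 1)) (z : Cspace n) :
    part01 (omega e A z) = 0 := by
  ext v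
  rw [part01_apply]
  simp only [omega, ContinuousLinearMap.coe_restrictScalars', innerSL_apply_apply, inner_smul_right,
    zero_apply]
  linear_combination (1 / 2 * inner ℂ (e A z) v) * I_sq

theorem part01_conjForm_apply (φ : OneForm n) (v : Cspace n) :
    part01 (conjForm φ) v = (starRingEnd ℂ) (part10 φ v) := by
  simp [part10_apply, part01_apply, conjForm, map_ofNat]

theorem omega_apply (e : Fin (n + 1) → Cspace n → Cspace n) (A : Fin (n + 1)) (z v : Cspace n) :
    omega e A z v = inner ℂ (e A z) v := rfl

theorem comp_eq (e : Fin (n + 1) → Cspace n → Cspace n) (u : Cspace n → ℂ) (A : Fin (n + 1)) :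
    comp e u A = fun x => part10 (d u x) (e A x) := by
  ext x; rw [comp, coeff, del, part10_part10]

theorem compBar_eq (e : Fin (n + 1) → Cspace n → Cspace n) (u : Cspace n → ℂ) (A : Fin (n + 1)) :
    compBar e u A = fun x => part01 (d u x) (e A x) := by
  ext x; rw [compBar, coeffBar, delBar, part01_part01]

/-! ### The (0,1)-derivatives of the Hopf frame. -/

section Frame

variable {U : Set (Cspace n)} {e : Fin (n + 1) → Cspace n → Cspace n} (he : IsHopfFrame U e)
  {z : Cspace n} (hz : z ∈ U)
include he hz

theorem IsHopfFrame.inner_eq (A B : Fin (n + 1)) :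
    inner ℂ (e A z) (e B z) = if A = B then (1 : ℂ) else 0 :=
  (orthonormal_iff_ite.mp (he.unitary z hz)) A B

theorem IsHopfFrame.ne_zero : z ≠ 0 := he.subset hz

theorem IsHopfFrame.exp_t : Real.exp (t z) = ‖z‖ :=
  Real.exp_log (norm_pos_iff.mpr (he.ne_zero hz))

theorem IsHopfFrame.exp_neg_t : Real.exp (-t z) = ‖z‖⁻¹ := by
  rw [Real.exp_neg, he.exp_t hz]

theorem IsHopfFrame.differentiableAt (A : Fin (n + 1)) : DifferentiableAt ℝ (e A) z :=
  ((he.smooth A).contDiffAt (he.isOpen.mem_nhds hz)).differentiableAt (by simp)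

theorem IsHopfFrame.thetaCoeff_dT (f : Cspace n → ℂ) (α : Fin n) :
    thetaCoeff e α z (dT e f z) = ‖z‖ * part10 (d f z) (e α.succ z) := by
  rw [thetaCoeff, he.exp_t hz, coeff, dT, part10_sub, part10_sub, part10_smul_form,
    part10_smul_form, part10_omega]
  simp [part10_conjForm_apply, part01_omega, omega_apply, he.inner_eq hz,
    (Fin.succ_ne_zero α).symm]

theorem IsHopfFrame.thetaCoeffBar_dT (f : Cspace n → ℂ) (α : Fin n) :
    thetaCoeffBar e α z (dT e f z) = ‖z‖ * part01 (d f z) (e α.succ z) := by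
  rw [thetaCoeffBar, he.exp_t hz, coeffBar, dT, part01_sub, part01_sub, part01_smul_form,
    part01_smul_form, part01_omega]
  simp [part01_conjForm_apply, part10_omega, omega_apply, he.inner_eq hz,
    (Fin.succ_ne_zero α).symm]

theorem IsHopfFrame.inner_fderiv (A B : Fin (n + 1)) (v : Cspace n) :
    inner ℂ (e A z) (fderiv ℝ (e B) z v) + inner ℂ (fderiv ℝ (e A) z v) (e B z) = 0 := by
  rw [← fderiv_inner_apply ℂ (he.differentiableAt hz A) (he.differentiableAt hz B)]
  have h : (fun x => inner ℂ (e A x) (e B x)) =ᶠ[nhds z]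
      fun _ => if A = B then (1 : ℂ) else 0 := by
    filter_upwards [he.isOpen.mem_nhds hz] with x hx using he.inner_eq hx A B
  rw [h.fderiv_eq]
  simp

/-- Differentiate `|z| e_0 = z`. The derivative of `|z|` is then found by pairing with `e_0`, since
`⟨e_0, de_0⟩` is purely imaginary. -/
theorem IsHopfFrame.fderiv_zero (v : Cspace n) :
    fderiv ℝ (e 0) z v = (‖z‖⁻¹ : ℂ) • (v - ((inner ℂ (e 0 z) v).re : ℂ) • e 0 z) := by
  have hn : DifferentiableAt ℝ (fun x : Cspace n => ‖x‖) z :=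
    differentiableAt_id.norm ℂ (he.ne_zero hz)
  have h : (fun x : Cspace n => ‖x‖ • e 0 x) =ᶠ[nhds z] id := by
    filter_upwards [he.isOpen.mem_nhds hz] with x hx
    rw [← he.exp_t hx]
    exact (he.radial x hx).symm
  have h1 : v = ‖z‖ • fderiv ℝ (e 0) z v + (fderiv ℝ (fun x : Cspace n => ‖x‖) z v) • e 0 z := by
    have h2 := h.fderiv_eq (𝕜 := ℝ)
    rw [fderiv_fun_smul hn (he.differentiableAt hz 0), fderiv_id] at h2
    simpa using (DFunLike.congr_fun h2 v).symm
  have hr : (inner ℂ (e 0 z) (fderiv ℝ (e 0) z v)).re = 0 := by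
    have h3 := congrArg Complex.re (he.inner_fderiv hz 0 0 v)
    rw [← inner_conj_symm (fderiv ℝ (e 0) z v)] at h3
    simp only [add_re, conj_re, zero_re] at h3
    linarith
  set c := fderiv ℝ (fun x : Cspace n => ‖x‖) z v
  have hc : (inner ℂ (e 0 z) v).re = c := by
    have h5 : ‖e 0 z‖ = 1 := (he.unitary z hz).1 0
    have h4 := congrArg (fun x => (inner ℂ (e 0 z) x).re) h1
    simpa [inner_add_right, ← coe_smul, inner_smul_right, hr, h5] using h4
  have hz0 : (‖z‖ : ℂ) ≠ 0 := by simpa using he.ne_zero hz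
  rw [hc]
  conv_rhs => rw [h1]
  rw [coe_smul, add_sub_cancel_right, ← coe_smul, smul_smul, inv_mul_cancel₀ hz0, one_smul]

theorem IsHopfFrame.dbarVec_zero (a : Cspace n) :
    dbarVec (e 0) z a
      = (-(1 / 2 * (‖z‖⁻¹ : ℂ) * (starRingEnd ℂ) (inner ℂ (e 0 z) a))) • e 0 z := by
  have h : (starRingEnd ℂ) (inner ℂ (e 0 z) a)
      = (inner ℂ (e 0 z) a).re - (inner ℂ (e 0 z) a).im * I := by
    generalize inner ℂ (e 0 z) a = c
    apply Complex.ext <;> simp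
  rw [dbarVec, he.fderiv_zero hz, he.fderiv_zero hz, inner_smul_right, I_mul_re, h]
  push_cast
  match_scalars
  · linear_combination (1 / 2 * (‖z‖⁻¹ : ℂ)) * I_sq
  · ring

/-- Orthogonality of `e_0` and `e_β` moves the derivative onto `e_0`, where it is known; `de_β`
itself is not determined. -/
theorem IsHopfFrame.inner_zero_fderiv_succ (β : Fin n) (v : Cspace n) :
    inner ℂ (e 0 z) (fderiv ℝ (e β.succ) z v)
      = -((‖z‖⁻¹ : ℂ) * (starRingEnd ℂ) (inner ℂ (e β.succ z) v)) := by
  rw [eq_neg_of_add_eq_zero_left (he.inner_fderiv hz 0 β.succ v), he.fderiv_zero hz,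
    inner_smul_left, inner_sub_left, inner_smul_left, he.inner_eq hz, inner_conj_symm]
  simp [(Fin.succ_ne_zero β).symm]

theorem IsHopfFrame.inner_zero_dbarVec_succ (α β : Fin n) :
    inner ℂ (e 0 z) (dbarVec (e β.succ) z (e α.succ z))
      = if α = β then -(‖z‖⁻¹ : ℂ) else 0 := by
  rw [dbarVec, inner_smul_right, inner_add_right, inner_smul_right,
    he.inner_zero_fderiv_succ hz, he.inner_zero_fderiv_succ hz, inner_smul_right,
    he.inner_eq hz, map_mul, conj_I]
  by_cases h : α = β
  · simp only [h, if_true, map_one]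
    linear_combination (1 / 2 * (‖z‖⁻¹ : ℂ)) * I_sq
  · simp [h, Ne.symm h]

omit he hz in
theorem part01_omegaConn (B C : Fin (n + 1)) (a : Cspace n) :
    part01 (omegaConn e B C z) a = inner ℂ (e B z) (dbarVec (e C) z a) := by
  rw [part01_apply, dbarVec, inner_smul_right, inner_add_right, inner_smul_right]
  rfl

theorem IsHopfFrame.part01_omegaConn_zero (α : Fin n) :
    part01 (omegaConn e 0 0 z) (e α.succ z) = 0 := by
  rw [part01_omegaConn, he.dbarVec_zero hz, he.inner_eq hz]
  simp [(Fin.succ_ne_zero α).symm]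

/-- The frame at a point as an orthonormal basis. -/
noncomputable def IsHopfFrame.basis : OrthonormalBasis (Fin (n + 1)) ℂ (Cspace n) :=
  (basisOfOrthonormalOfCardEqFinrank (he.unitary z hz) (by simp)).toOrthonormalBasis
    (by simpa using he.unitary z hz)

theorem IsHopfFrame.basis_apply (A : Fin (n + 1)) : he.basis hz A = e A z := by
  simp [IsHopfFrame.basis]

/-! ### Frame components as values of the Hessian. -/

variable {f : Cspace n → ℂ} (hf : DifferentiableAt ℝ (d f) z)
include hf

theorem IsHopfFrame.coeff_d_compBar (A B : Fin (n + 1)) :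
    coeff e A z (d (compBar e f B) z)
      = hess f z (e A z) (e B z) + part01 (d f z) (dbarVec (e B) z (e A z)) := by
  rw [coeff, compBar_eq, d, part10_fderiv_part01 f _ z hf (he.differentiableAt hz B), dbarVec]

theorem IsHopfFrame.radialRadialBar_add :
    radialRadialBar e f z + 1 / 2 * compBar e f 0 z = ‖z‖ * hess f z (e 0 z) (e 0 z) := by
  have hz0 : (‖z‖ : ℂ) ≠ 0 := by simpa using he.ne_zero hz
  rw [radialRadialBar, he.exp_t hz, he.coeff_d_compBar hz hf, he.dbarVec_zero hz, part01_smul,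
    compBar_eq, he.inner_eq hz]
  simp [map_ofNat]
  field_simp
  ring

theorem IsHopfFrame.transRadialBar_eq (α : Fin n) :
    transRadialBar e f α z = ‖z‖ * hess f z (e α.succ z) (e 0 z) := by
  rw [transRadialBar, he.thetaCoeff_dT hz, ← coeff, he.coeff_d_compBar hz hf, he.dbarVec_zero hz,
    he.inner_eq hz]
  simp [(Fin.succ_ne_zero α).symm]

theorem IsHopfFrame.transBarRadial_eq (hsymm : ∀ v w, d2 f z v w = d2 f z w v) (α : Fin n) :
    transBarRadial e f α z = ‖z‖ * hess f z (e 0 z) (e α.succ z) := by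
  rw [transBarRadial, he.thetaCoeffBar_dT hz, comp_eq, d,
    part01_fderiv_part10 f _ z hf (he.differentiableAt hz 0) hsymm, ← dbarVec,
    he.dbarVec_zero hz, he.inner_eq hz]
  simp [(Fin.succ_ne_zero α).symm]

theorem IsHopfFrame.transHess_eq (α β : Fin n) :
    transHess e f α β z = ‖z‖ * hess f z (e α.succ z) (e β.succ z) := by
  have hz0 : (‖z‖ : ℂ) ≠ 0 := by simpa using he.ne_zero hz
  -- Expanding `(∂̄e_β)(e_α)` in the frame, the `e_0`-term cancels `u_{0̄}δ_{αβ}` and the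
  -- `e_γ`-terms cancel the connection forms of `∇`.
  have h1 : part01 (d f z) (dbarVec (e β.succ) z (e α.succ z))
      = (if α = β then -(‖z‖⁻¹ : ℂ) else 0) * compBar e f 0 z
        + ∑ γ : Fin n, compBar e f γ.succ z * part10 (conjForm (thetaConn e γ β z)) (e α.succ z) := by
    conv_lhs => rw [← (he.basis hz).sum_repr (dbarVec (e β.succ) z (e α.succ z))]
    simp only [map_sum, part01_smul, (he.basis hz).repr_apply_apply, he.basis_apply]
    rw [Fin.sum_univ_succ, he.inner_zero_dbarVec_succ hz]
    congr 1
    · rw [compBar_eq]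
      split_ifs <;> simp
    · refine Finset.sum_congr rfl fun γ _ => ?_
      rw [part10_conjForm_apply, thetaConn, part01_sub, sub_apply, part01_omegaConn, compBar_eq]
      -- The shift by `ω^0_0` in `θ^γ_β` is invisible here: `∂̄e_0` vanishes on `e_α`.
      have : part01 (if γ = β then omegaConn e 0 0 z else 0) (e α.succ z) = 0 := by
        split_ifs
        · exact he.part01_omegaConn_zero hz α
        · simp [part01_apply]
      rw [this, sub_zero, mul_comm]
  have h2 : transTransBar e f α β z = ‖z‖ * (part10 (d (compBar e f β.succ) z) (e α.succ z)
      - ∑ γ : Fin n, compBar e f γ.succ z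
        * part10 (conjForm (thetaConn e γ β z)) (e α.succ z)) := by
    have h3 := he.thetaCoeff_dT hz (compBar e f β.succ) α
    rw [thetaCoeff, he.exp_t hz, coeff] at h3
    rw [transTransBar, thetaCoeff, he.exp_t hz, coeff, nablaBar, part10_sub, sub_apply, mul_sub, h3,
      mul_sub, part10_sum, sum_apply]
    simp only [part10_smul_form, smul_apply, smul_eq_mul]
  rw [transHess, h2, ← coeff, he.coeff_d_compBar hz hf, h1]
  split_ifs
  · field_simp
    ring
  · ring

end Frame

/-! ### Plurisubharmonicity and positivity of the Hessian. -/

/-- Mean value inequality for the remainder on the closed ball of radius `‖h‖`: by symmetry of `D`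
its derivative is `f'(z + x) - f'(z) - D x`, which is at most `ε‖h‖` because `D` is the derivative
of `f'` at `z`. -/
theorem exists_taylor_bound {E F : Type*} [NormedAddCommGroup E] [NormedSpace ℝ E]
    [NormedAddCommGroup F] [NormedSpace ℝ F] {f : E → F} {z : E} (hf : ContDiffAt ℝ 2 f z)
    {ε : ℝ} (hε : 0 < ε) :
    ∃ δ > 0, ∀ h : E, ‖h‖ < δ →
      ‖f (z + h) - f z - fderiv ℝ f z h - (1 / 2 : ℝ) • fderiv ℝ (fderiv ℝ f) z h h‖
        ≤ ε * ‖h‖ ^ 2 := by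
  have hsymm : IsSymmSndFDerivAt ℝ f z := hf.isSymmSndFDerivAt (by simp)
  set D := fderiv ℝ (fderiv ℝ f) z with hD
  have hd : HasFDerivAt (fderiv ℝ f) D z :=
    ((hf.fderiv_right (m := 1) (by norm_num)).differentiableAt (by simp)).hasFDerivAt
  have h1 : ∀ᶠ x in nhds z, DifferentiableAt ℝ f x :=
    (hf.eventually (by simp)).mono fun x hx => hx.differentiableAt (by simp)
  obtain ⟨δ, hδ, hball⟩ := Metric.eventually_nhds_iff.mp
    (h1.and (hd.isLittleO.def hε))
  refine ⟨δ, hδ, fun h hh => ?_⟩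
  have key : ∀ x ∈ Metric.closedBall (0 : E) ‖h‖,
      HasFDerivWithinAt (fun x => f (z + x) - fderiv ℝ f z x - (1 / 2 : ℝ) • D x x)
        (fderiv ℝ f (z + x) - fderiv ℝ f z - D x) (Metric.closedBall (0 : E) ‖h‖) x := by
    intro x hx
    have hx' : dist (z + x) z < δ := by simpa using (mem_closedBall_zero_iff.mp hx).trans_lt hh
    have ha : HasFDerivAt (fun x => f (z + x)) (fderiv ℝ f (z + x)) x := by
      have := (hball hx').1.hasFDerivAt.comp x ((hasFDerivAt_id x).const_add z)
      simpa [Function.comp_def] using this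
    have hb := (D.hasFDerivAt (x := x)).clm_apply (hasFDerivAt_id x)
    refine (((ha.sub (fderiv ℝ f z).hasFDerivAt).sub
      (hb.const_smul (1 / 2 : ℝ))).congr_fderiv ?_).hasFDerivWithinAt
    ext k
    have : D k x = D x k := hsymm k x
    simp only [sub_apply, smul_apply, add_apply, ContinuousLinearMap.comp_apply,
      ContinuousLinearMap.flip_apply, id_eq, this, ContinuousLinearMap.id_apply]
    module
  have bound : ∀ x ∈ Metric.closedBall (0 : E) ‖h‖,
      ‖fderiv ℝ f (z + x) - fderiv ℝ f z - D x‖ ≤ ε * ‖h‖ := by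
    intro x hx
    have hx0 := mem_closedBall_zero_iff.mp hx
    have hx' : dist (z + x) z < δ := by simpa using hx0.trans_lt hh
    have := (hball hx').2
    rw [add_sub_cancel_left] at this
    exact this.trans (by gcongr)
  have := (convex_closedBall (0 : E) ‖h‖).norm_image_sub_le_of_norm_hasFDerivWithin_le key bound
    (Metric.mem_closedBall_self (norm_nonneg h)) (mem_closedBall_zero_iff.mpr le_rfl)
  simp only [add_zero, map_zero, sub_zero, smul_zero] at this
  calc _ = _ := by congr 1; abel
    _ ≤ _ := this
    _ = _ := by ring

theorem circleAverage_rotate (g : ℂ → ℝ) :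
    Real.circleAverage (fun ζ => g (I * ζ)) 0 1 = Real.circleAverage g 0 1 := by
  rw [Real.circleAverage_eq_integral_add (f := g) (Real.pi / 2), Real.circleAverage_def]
  congr 2
  ext θ
  congr 1
  simp only [circleMap_zero, ofReal_add, add_mul, exp_add]
  push_cast
  rw [exp_pi_div_two_mul_I]
  ring

theorem hess_self (f : Cspace n → ℂ) (z w : Cspace n) (hsymm : ∀ v w, d2 f z v w = d2 f z w v) :
    hess f z w w = 1 / 4 * (d2 f z w w + d2 f z (I • w) (I • w)) := by
  rw [hess_apply', hsymm (I • w) w]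
  ring

theorem d2_im_eq_zero {u : Cspace n → ℝ} {z : Cspace n}
    (hu : ContDiffAt ℝ 2 (fun x => (u x : ℂ)) z) (a b : Cspace n) :
    (d2 (fun x => (u x : ℂ)) z a b).im = 0 := by
  set f := fun x => (u x : ℂ) with hf
  have h1 : ∀ᶠ x in nhds z, imCLM (d f x b) = 0 := by
    filter_upwards [hu.eventually (by simp)] with x hx
    have h2 := (imCLM.hasFDerivAt.comp x (hx.differentiableAt (by simp)).hasFDerivAt).fderiv
    have h3 : imCLM ∘ f = fun _ => (0 : ℝ) := by ext; simp [hf]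
    rw [h3, fderiv_const_apply] at h2
    exact (DFunLike.congr_fun h2 b).symm
  have hd : HasFDerivAt (d f) (d2 f z) z :=
    ((hu.fderiv_right (m := 1) (by norm_num)).differentiableAt (by simp)).hasFDerivAt
  have h4 := imCLM.hasFDerivAt.comp z (hd.clm_apply (hasFDerivAt_const b z))
  have h5 := h4.unique ((hasFDerivAt_const (0 : ℝ) z).congr_of_eventuallyEq h1)
  simpa using DFunLike.congr_fun h5 a

/-- Averaging over the four rotations `h, ih, -h, -ih` cancels the first-order terms and turns the
second-order ones into `H(h, h)`, so no integral of the Taylor polynomial is needed. A negative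
`H(w, w)` would then violate the sub-mean value inequality on a small disc. -/
theorem hess_self_nonneg {u : Cspace n → ℝ} {Ω : Set (Cspace n)} (hΩ : IsOpen Ω)
    (hpsh : PshOn u Ω) {z : Cspace n} (hz : z ∈ Ω) (hcont : ContinuousOn u Ω)
    (hu : ContDiffAt ℝ 2 (fun x => (u x : ℂ)) z) (w : Cspace n) :
    0 ≤ hess (fun x => (u x : ℂ)) z w w := by
  set f := fun x => (u x : ℂ) with hf
  have hsymm : ∀ v w, d2 f z v w = d2 f z w v := hu.isSymmSndFDerivAt (by simp)
  have him : (hess f z w w).im = 0 := by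
    have : (1 / 4 : ℂ) = ((1 / 4 : ℝ) : ℂ) := by push_cast; rfl
    rw [hess_self f z w hsymm, this, im_ofReal_mul, add_im, d2_im_eq_zero hu, d2_im_eq_zero hu]
    simp
  rw [Complex.nonneg_iff]
  refine ⟨?_, him.symm⟩
  by_contra! hneg
  set L := (hess f z w w).re with hL
  have hw : 0 < ‖w‖ ^ 2 + 1 := by positivity
  -- With this `ε` the Taylor error at `‖h‖ = s‖w‖` is at most `-s²L/2`, half the size of the
  -- average gain `s²L`; the `+ 1` covers `w = 0`.
  obtain ⟨δ, hδ, htaylor⟩ := exists_taylor_bound hu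
    (ε := -L / (2 * (‖w‖ ^ 2 + 1))) (by apply div_pos <;> linarith)
  obtain ⟨r, hr, hrΩ⟩ := Metric.isOpen_iff.mp hΩ z hz
  obtain ⟨s, hs, hsδ⟩ : ∃ s > 0, s * ‖w‖ < min δ r := by
    refine ⟨min δ r / (2 * (‖w‖ + 1)), by positivity, ?_⟩
    have : 0 < min δ r := lt_min hδ hr
    rw [div_mul_eq_mul_div, div_lt_iff₀ (by positivity)]
    nlinarith [norm_nonneg w]
  have hnorm : ∀ ζ : ℂ, ‖ζ‖ ≤ 1 → ‖ζ • (s : ℂ) • w‖ ≤ s * ‖w‖ := by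
    intro ζ hζ
    rw [norm_smul, norm_smul, norm_real, Real.norm_of_nonneg hs.le]
    exact mul_le_of_le_one_left (by positivity) hζ
  have hmem : ∀ ζ : ℂ, ‖ζ‖ ≤ 1 → z + ζ • (s : ℂ) • w ∈ Ω := fun ζ hζ =>
    hrΩ (by simpa using ((hnorm ζ hζ).trans_lt hsδ).trans_le (min_le_right _ _))
  have hmean := hpsh.2 z ((s : ℂ) • w) hmem
  set g : ℂ → ℝ := fun ζ => u (z + ζ • (s : ℂ) • w) with hg
  have hgcont : ContinuousOn g (Metric.sphere 0 1) := by
    refine hcont.comp (by fun_prop) fun ζ hζ => hmem ζ ?_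
    simpa using (mem_sphere_zero_iff_norm.mp hζ).le
  have hrot : ∀ c : ℂ, ‖c‖ = 1 → CircleIntegrable (fun ζ => g (c * ζ)) 0 1 := by
    intro c hc
    refine ContinuousOn.circleIntegrable zero_le_one
      (hgcont.comp (by fun_prop) fun ζ hζ => ?_)
    simpa [hc] using hζ
  have hI := hrot I norm_I
  have hII := hrot (I * I) (by simp)
  have hIII := hrot (I * (I * I)) (by simp)
  have h0 := hrot 1 (by simp)
  simp only [one_mul] at h0
  have e1 := circleAverage_rotate g
  have e2 := circleAverage_rotate (fun ζ => g (I * ζ))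
  have e3 := circleAverage_rotate (fun ζ => g (I * (I * ζ)))
  simp only [← mul_assoc] at e1 e2 e3
  simp only [← mul_assoc] at hIII
  have hsum : Real.circleAverage
      (((g + fun ζ => g (I * ζ)) + fun ζ => g (I * I * ζ)) + fun ζ => g (I * I * I * ζ)) 0 1
        = 4 * Real.circleAverage g 0 1 := by
    rw [Real.circleAverage_add ((h0.add hI).add hII) hIII, Real.circleAverage_add (h0.add hI) hII,
      Real.circleAverage_add h0 hI, e3, e2, e1]
    ring
  -- The four quadratic terms sum to `4s²L` and the four errors to at most `-2s²L`, which leaves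
  -- `2s²L < 0`.
  have hle := Real.circleAverage_mono_on_of_le_circle (((h0.add hI).add hII).add hIII)
    (a := 4 * u z + 2 * s ^ 2 * L) (fun ζ hζ => ?_)
  · rw [hsum] at hle
    nlinarith [mul_pos (pow_pos hs 2) (neg_pos.mpr hneg)]
  have hζ1 : ‖ζ‖ = 1 := by simpa using hζ
  set h := ζ • (s : ℂ) • w with hh
  have hhn : ‖h‖ = s * ‖w‖ := by
    rw [hh, norm_smul, norm_smul, norm_real, Real.norm_of_nonneg hs.le, hζ1, one_mul]
  have hT : ∀ k : Cspace n, ‖k‖ = s * ‖w‖ →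
      u (z + k) ≤ u z + (fderiv ℝ f z k).re + 1 / 2 * (d2 f z k k).re + s ^ 2 * (-L / 2) := by
    intro k hk
    have := htaylor k (by rw [hk]; exact hsδ.trans_le (min_le_left _ _))
    have h2 := (re_le_norm _).trans this
    simp only [sub_re, real_smul, re_ofReal_mul, hf, ofReal_re] at h2
    have h3 : -L / (2 * (‖w‖ ^ 2 + 1)) * ‖k‖ ^ 2 ≤ s ^ 2 * (-L / 2) := by
      rw [hk, div_mul_eq_mul_div, div_le_iff₀ (by positivity)]
      nlinarith [mul_pos (pow_pos hs 2) (neg_pos.mpr hneg)]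
    simp only [d2]
    change _ ≤ _ + _ + 1 / 2 * (fderiv ℝ (fderiv ℝ f) z k k).re + _
    linarith
  have hquad : 2 * (d2 f z h h).re + 2 * (d2 f z (I • h) (I • h)).re = 8 * s ^ 2 * L := by
    have h1 := hess_self f z h hsymm
    have h2 : hess f z h h = ((s ^ 2 : ℝ) : ℂ) * hess f z w w := by
      have : ζ * (starRingEnd ℂ) ζ = 1 := by rw [mul_conj, normSq_eq_norm_sq, hζ1]; simp
      rw [hh]
      simp only [map_smul, map_smulₛₗ, LinearMap.smul_apply, smul_eq_mul, conj_ofReal]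
      push_cast
      linear_combination (s ^ 2 * hess f z w w) * this
    have h3 := congrArg Complex.re (h1.symm.trans h2)
    have h4 : (1 / 4 : ℂ) = ((1 / 4 : ℝ) : ℂ) := by push_cast; rfl
    rw [re_ofReal_mul, h4, re_ofReal_mul, add_re] at h3
    linarith
  have t1 := hT h hhn
  have t2 := hT (I • h) (by rw [norm_smul, norm_I, one_mul, hhn])
  have t3 := hT (-h) (by rw [norm_neg, hhn])
  have t4 := hT (-(I • h)) (by rw [norm_neg, norm_smul, norm_I, one_mul, hhn])
  have g2 : g (I * ζ) = u (z + I • h) := by simp only [hg, hh, mul_smul]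
  have g3 : g (I * I * ζ) = u (z + -h) := by simp [hg, hh]
  have g4 : g (I * I * I * ζ) = u (z + -(I • h)) := by simp [hg, hh, mul_smul]
  simp only [map_neg, neg_apply, neg_re, neg_neg] at t3 t4
  simp only [Pi.add_apply, g2, g3, g4]
  change u (z + h) + _ + _ + _ ≤ _
  linarith

/-! ### The transversal form and the theorem. -/

/-- The two sums are the projections `Pv`, `Pw` to the complement of `e_0`. As `P` is complex
linear, type (1,1) and positivity are inherited from `H`. -/
theorem IsHopfFrame.transverse_apply {U : Set (Cspace n)} {e : Fin (n + 1) → Cspace n → Cspace n}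
    (he : IsHopfFrame U e) {z : Cspace n} (hz : z ∈ U) {f : Cspace n → ℂ}
    (hf : DifferentiableAt ℝ (d f) z) (v w : Cspace n) :
    (∑ α, ∑ β, transHess e f α β z •
      (I • wedge (theta e α z) (conjForm (theta e β z)))) ![v, w]
      = I * (‖z‖⁻¹ : ℂ) *
        (hess f z (∑ α : Fin n, (inner ℂ (e α.succ z) v : ℂ) • e α.succ z)
            (∑ α : Fin n, (inner ℂ (e α.succ z) w : ℂ) • e α.succ z)
          - hess f z (∑ α : Fin n, (inner ℂ (e α.succ z) w : ℂ) • e α.succ z)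
            (∑ α : Fin n, (inner ℂ (e α.succ z) v : ℂ) • e α.succ z)) := by
  have hz0 : (‖z‖ : ℂ) ≠ 0 := by simpa using he.ne_zero hz
  simp only [map_sum, LinearMap.sum_apply, map_smul, map_smulₛₗ, LinearMap.smul_apply,
    ← Finset.sum_sub_distrib, Finset.mul_sum, ContinuousAlternatingMap.sum_apply,
    ContinuousAlternatingMap.smul_apply, wedge_apply, he.transHess_eq hz hf]
  rw [Finset.sum_comm]
  refine Finset.sum_congr rfl fun i _ => ?_
  rw [Finset.smul_sum, Finset.smul_sum, ← Finset.sum_sub_distrib, Finset.mul_sum]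
  refine Finset.sum_congr rfl fun j _ => ?_
  simp only [theta, conjForm, ContinuousLinearMap.comp_apply, smul_apply, omega_apply,
    he.exp_neg_t hz, smul_eq_mul, real_smul, ContinuousLinearEquiv.coe_coe, conjCLE_apply,
    map_mul, map_inv₀, conj_ofReal, ofReal_inv]
  field_simp

end HopfFrame

open HopfFrame
theorem theorem6p1 (n : ℕ) (u : Cspace n → ℝ) (hu : ContDiffOn ℝ ∞ u (punctured n))
    (U : Set (Cspace n)) (e : Fin (n + 1) → Cspace n → Cspace n) (he : IsHopfFrame U e) :
    (∀ z ∈ U, delDelBar (fun x => (u x : ℂ)) z =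
      (Real.exp (-t z) * (radialRadialBar e (fun x => (u x : ℂ)) z
          + 1 / 2 * compBar e (fun x => (u x : ℂ)) 0 z)) •
        wedge (omega e 0 z) (conjForm (omega e 0 z))
      + ∑ α, transBarRadial e (fun x => (u x : ℂ)) α z •
          wedge (omega e 0 z) (conjForm (theta e α z))
      + ∑ α, transRadialBar e (fun x => (u x : ℂ)) α z •
          wedge (theta e α z) (conjForm (omega e 0 z))
      + ∑ α, ∑ β, (Real.exp (t z) * transHess e (fun x => (u x : ℂ)) α β z) •
          wedge (theta e α z) (conjForm (theta e β z))) ∧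
    (PshOn u (punctured n) → ∀ z ∈ U,
      0 ≤ radialRadialBar e (fun x => (u x : ℂ)) z
          + 1 / 2 * compBar e (fun x => (u x : ℂ)) 0 z ∧
      IsPositive (∑ α, ∑ β, transHess e (fun x => (u x : ℂ)) α β z •
          (Complex.I • wedge (theta e α z) (conjForm (theta e β z))))) := by
  have hopen : IsOpen (punctured n) := isOpen_compl_singleton
  have hu2 : ∀ z ∈ U, ContDiffAt ℝ 2 (fun x => (u x : ℂ)) z := fun z hz =>
    Complex.ofRealCLM.contDiff.contDiffAt.comp z
      ((hu.contDiffAt (hopen.mem_nhds (he.subset hz))).of_le (WithTop.coe_le_coe.mpr le_top))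
  have hd : ∀ z ∈ U, DifferentiableAt ℝ (d fun x => (u x : ℂ)) z := fun z hz =>
    ((hu2 z hz).fderiv_right (m := 1) (by norm_num)).differentiableAt (by simp)
  -- The equation `hf` is kept: the positivity part must return to the real-valued `u`.
  generalize hf : (fun x => (u x : ℂ)) = f at *
  refine ⟨fun z hz => ?_, fun hpsh z hz => ?_⟩
  · have hz0 : (‖z‖ : ℂ) ≠ 0 := by simpa using he.ne_zero hz
    have hsymm : ∀ v w, d2 f z v w = d2 f z w v := (hu2 z hz).isSymmSndFDerivAt (by simp)
    rw [he.radialRadialBar_add hz (hd z hz)]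
    simp only [he.transBarRadial_eq hz (hd z hz) hsymm, he.transRadialBar_eq hz (hd z hz),
      he.transHess_eq hz (hd z hz), he.exp_t hz, he.exp_neg_t hz]
    ext m
    have hm : m = ![m 0, m 1] := by ext i; fin_cases i <;> rfl
    generalize m 0 = v at hm
    generalize m 1 = w at hm
    subst hm
    rw [delDelBar_apply f z (hd z hz), sesquilinear_expand _ (he.basis hz) v w,
      sesquilinear_expand _ (he.basis hz) w v]
    simp only [← Finset.sum_sub_distrib]
    -- Splitting off index `0` in both sums gives the four blocks of the formula; only powers of
    -- `|z|` remain to be matched.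
    simp only [he.basis_apply, Fin.sum_univ_succ (n := n), Finset.sum_add_distrib,
      ContinuousAlternatingMap.add_apply, ContinuousAlternatingMap.sum_apply,
      ContinuousAlternatingMap.smul_apply, wedge_apply, theta, conjForm, omega_apply,
      ContinuousLinearMap.comp_apply, smul_apply, he.exp_neg_t hz, smul_eq_mul, Complex.real_smul,
      ContinuousLinearEquiv.coe_coe, Complex.conjCLE_apply, map_mul, Complex.conj_ofReal,
      Complex.ofReal_inv, map_inv₀]
    rw [← add_assoc]
    refine congrArg₂ _ (congrArg₂ _ (congrArg₂ _ ?_ ?_) ?_) ?_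
    · field_simp
    · refine Finset.sum_congr rfl fun α _ => ?_
      field_simp
    · refine Finset.sum_congr rfl fun α _ => ?_
      field_simp
    · refine Finset.sum_congr rfl fun α _ => Finset.sum_congr rfl fun β _ => ?_
      field_simp
  · have hz0 : 0 ≤ (‖z‖ : ℂ) := by exact_mod_cast norm_nonneg z
    have hpos : ∀ w, 0 ≤ hess f z w w := by
      have h := hu2 z hz
      rw [← hf] at h ⊢
      exact hess_self_nonneg hopen hpsh (he.subset hz) hu.continuousOn h
    refine ⟨?_, fun v w => ?_, fun v => ?_⟩
    · rw [he.radialRadialBar_add hz (hd z hz)]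
      exact mul_nonneg hz0 (hpos _)
    · have hI : ∀ x : Cspace n, mulI n x = Complex.I • x := fun _ => rfl
      rw [he.transverse_apply hz (hd z hz), he.transverse_apply hz (hd z hz)]
      simp only [hI, inner_smul_right, mul_smul, ← Finset.smul_sum, map_smul, map_smulₛₗ,
        LinearMap.smul_apply, smul_eq_mul, Complex.conj_I]
      ring_nf
      simp
      ring
    · have hI : mulI n v = Complex.I • v := rfl
      rw [he.transverse_apply hz (hd z hz)]
      simp only [hI, inner_smul_right, mul_smul, ← Finset.smul_sum, map_smul, map_smulₛₗ,
        LinearMap.smul_apply, smul_eq_mul, Complex.conj_I]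
      -- For `w = iv` the difference is `H(Pv, iPv) - H(iPv, Pv) = -2i H(Pv, Pv)`, so the form takes
      -- the value `2|z|⁻¹ H(Pv, Pv)`.
      have h := mul_nonneg (mul_nonneg zero_le_two (inv_nonneg.mpr hz0))
        (hpos (∑ α : Fin n, (inner ℂ (e α.succ z) v : ℂ) • e α.succ z))
      refine h.trans_eq ?_
      ring_nf
      simp
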